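/- Let $m \ge 2$ and $n \ge 1$ be integers, and let $\mathcal{A} = (a_{i_1 \cdots i_m})$, $1 \le i_1, \dots, i_m \le n$, be a real tensor of order $m$ and dimension $n$ (not necessarily symmetric). For $x \in \mathbb{R}^n$ let $\mathcal{A}x^{m-1} \in \mathbb{R}^n$ be the vector with components $$(\mathcal{A}x^{m-1})_i = \sum_{i_2, \dots, i_m = 1}^n a_{i i_2 \cdots i_m} x_{i_2} \cdots x_{i_m}, \qquad i = 1, \dots, n.$$ Inequalities between vectors are understood componentwise. Consider, for $x \in \mathbb{R}^n$ and $t \in \mathbb{R}$, the system $$0 \ne x \ge 0, \quad t \ge 0, \quad (\mathcal{A}x^{m-1})_i + t = 0 \text{ whenever } x_i > 0, \quad (\mathcal{A}x^{m-1})_j + t \ge 0 \text{ whenever } x_j = 0. \qquad (*)$$ The tensor $\mathcal{A}$ is called - an R-tensor if $(*)$ has no solution $(x,t)$; - an R$_0$-tensor if $(*)$ has no solution $(x,t)$ with $t = 0$; - semi-positive if for every $x \ge 0$ with $x \neq 0$ there is an index $k$ such that $x_k > 0$ and $(\mathcal{A}x^{m-1})_k \ge 0$; - a Q-tensor if for every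 $q \in \mathbb{R}^n$ there is an $x \in \mathbb{R}^n$ with $x \ge 0$, $q + \mathcal{A}x^{m-1} \ge 0$ and $x^\top (q + \mathcal{A}x^{m-1}) = 0$. Theorem. If $\mathcal{A}$ is a semi-positive R$_0$-tensor, then $\mathcal{A}$ is an R-tensor, and hence $\mathcal{A}$ is a Q-tensor. -/

import Mathlib

/-- Real `m`-th order `n`-dimensional tensors: multi-arrays of reals `a_{i₁ ⋯ iₘ}`, where every
index `i_k` ranges over `Fin n`. -/
abbrev RealTensor (m n : ℕ) : Type := (Fin m → Fin n) → ℝ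

namespace RealTensor

variable {m n : ℕ}

/-- The multi-index `(i, i₂, …, iₘ)` with first entry `i` and remaining `m - 1` entries given
by `j`. -/
def consIndex (i : Fin n) (j : Fin (m - 1) → Fin n) : Fin m → Fin n :=
  fun k => if h : (k : ℕ) = 0 then i else j ⟨(k : ℕ) - 1, by have := k.isLt; omega⟩

/-- The vector `A x^{m-1}`, whose `i`-th component is
`∑_{i₂, …, iₘ} a_{i i₂ ⋯ iₘ} x_{i₂} ⋯ x_{iₘ}`. -/
def applyVec (A : RealTensor m n) (x : Fin n → ℝ) : Fin n → ℝ :=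
  fun i => ∑ j : Fin (m - 1) → Fin n, A (consIndex i j) * ∏ l, x (j l)

/-- `x` solves the tensor complementarity problem `(q, A)`:
`x ≥ 0`, `q + A x^{m-1} ≥ 0` and `xᵀ (q + A x^{m-1}) = 0`. -/
def SolvesTCP (q : Fin n → ℝ) (A : RealTensor m n) (x : Fin n → ℝ) : Prop :=
  0 ≤ x ∧ 0 ≤ q + A.applyVec x ∧ dotProduct x (q + A.applyVec x) = 0

/-- `A` is a Q-tensor: the tensor complementarity problem `(q, A)` has a solution for every
vector `q`. -/
def IsQ (A : RealTensor m n) : Prop :=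
  ∀ q : Fin n → ℝ, ∃ x : Fin n → ℝ, SolvesTCP q A x

/-- The pair `(x, t)` satisfies the system `0 ≠ x ≥ 0`, `t ≥ 0`, `(A x^{m-1})_i + t = 0` if
`x_i > 0`, and `(A x^{m-1})_j + t ≥ 0` if `x_j = 0`. -/
def RSystem (A : RealTensor m n) (x : Fin n → ℝ) (t : ℝ) : Prop :=
  x ≠ 0 ∧ 0 ≤ x ∧ 0 ≤ t ∧
    (∀ i, 0 < x i → A.applyVec x i + t = 0) ∧
    (∀ j, x j = 0 → 0 ≤ A.applyVec x j + t)

/-- `A` is an R-tensor: the system `RSystem` is inconsistent. -/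
def IsR (A : RealTensor m n) : Prop :=
  ¬ ∃ (x : Fin n → ℝ) (t : ℝ), A.RSystem x t

/-- `A` is an R₀-tensor: the system `RSystem` is inconsistent for `t = 0`. -/
def IsR₀ (A : RealTensor m n) : Prop :=
  ¬ ∃ x : Fin n → ℝ, A.RSystem x 0

/-- `A` is semi-positive: for every `x ≥ 0`, `x ≠ 0`, there is an index `k` with `x_k > 0` and
`(A x^{m-1})_k ≥ 0`. -/
def IsSemiPositive (A : RealTensor m n) : Prop :=
  ∀ x : Fin n → ℝ, 0 ≤ x → x ≠ 0 → ∃ k, 0 < x k ∧ 0 ≤ A.applyVec x k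

end RealTensor

/-!
That `A` is an R-tensor is immediate: semi-positivity gives an index `k` with `x k > 0` and
`(A x^{m-1})_k ≥ 0`, so a solution of the system has `t = 0`, which the R₀ property excludes
(`RealTensor.IsSemiPositive.isR`).

That an R-tensor is a Q-tensor (`RealTensor.IsR.isQ`) is Karamardian's argument. Truncate the
orthant to `{x ≥ 0, ∑ x ≤ s}`. With a slack coordinate this is a scaled simplex, on which the
variational inequality for `x ↦ q + A x^{m-1}` is solvable. Its solution solves the full problem
unless `∑ x = s` and the multiplier `t` of this constraint is positive
(`RealTensor.exists_solvesTCP_or_truncated`). If that happens for arbitrarily large `s`, then by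
homogeneity the points `x / s` of the simplex solve the system with the error term
`q / s ^ (m - 1)`, and a limit point solves the system exactly, against the R property.

Solvability of the variational inequality for a continuous map `G` on the simplex
(`exists_mem_stdSimplex_complementarity`) has the strength of Brouwer's fixed point theorem. It is
derived from Scarf's lemma (`Scarf.exists_dominant_image_eq_univ`), applied to a grid on the simplex
in which a point is coloured by an index that minimises `G` there. Dominance forces the points of
the multicoloured set to be close together and all coordinates whose colour is supplied by a slack
element to be small, so in the limit every index with positive coordinate minimises `G`; no boundary
condition on the colouring is needed. Scarf's lemma itself is a parity argument, whose core is the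
pivoting step `Scarf.Dominant.exists_pivots`.
-/

/-! ### Scarf's lemma -/

namespace Scarf

open Finset

/-- If `f` maps `S` onto a set with one element fewer, then there are exactly two elements of `S`
that can be dropped without losing surjectivity, namely the two with the same image. -/
theorem exists_pair_image_erase_eq {α β : Type*} [DecidableEq α] [DecidableEq β] {S : Finset α}
    {f : α → β} {S' : Finset β} (himg : S.image f = S') (hcard : #S = #S' + 1) :
    ∃ a ∈ S, ∃ b ∈ S, a ≠ b ∧ f a = f b ∧
      ∀ x ∈ S, (S.erase x).image f = S' ↔ x = a ∨ x = b := by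
  obtain ⟨a, ha, b, hb, hab, hf⟩ := exists_ne_map_eq_of_card_lt_of_maps_to
    (s := S) (t := S') (f := f) (by omega) (fun x hx => himg ▸ mem_image_of_mem f hx)
  have key : ∀ u ∈ S, ∀ v ∈ S, u ≠ v → f u = f v → (S.erase u).image f = S' := by
    intro u hu v hv huv hfuv
    rw [← himg]
    refine Subset.antisymm (image_subset_image (erase_subset _ _)) ?_
    intro y hy
    obtain ⟨x, hx, rfl⟩ := mem_image.1 hy
    by_cases hxu : x = u
    · subst hxu
      exact mem_image.2 ⟨v, mem_erase.2 ⟨huv.symm, hv⟩, hfuv.symm⟩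
    · exact mem_image_of_mem f (mem_erase.2 ⟨hxu, hx⟩)
  refine ⟨a, ha, b, hb, hab, hf, fun x hx => ⟨fun h => ?_, ?_⟩⟩
  · by_contra! hne
    have hinj : Set.InjOn f (S.erase x) := by
      apply injOn_of_card_image_eq
      rw [h, card_erase_of_mem hx]
      omega
    exact hab (hinj (by simpa using ⟨ha, hne.1.symm⟩) (by simpa using ⟨hb, hne.2.symm⟩) hf)
  · rintro (rfl | rfl)
    · exact key _ ha b hb hab hf
    · exact key _ hb a ha hab.symm hf.symm

variable {I V : Type*}

/-- `B` is dominant for the orders on `V` given by the rankings `r i`, `i : I`, if no element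
of `V` lies strictly above the `i`-th minimum of `B` for all `i` at once. -/
def Dominant (r : I → V → ℕ) (B : Finset V) : Prop :=
  ∀ y, ∃ i, ∀ x ∈ B, r i y ≤ r i x

/-- `x` is the `r k`-largest among the elements that lie strictly above the point `m i` in the
`i`-th order for all `i ≠ k`. -/
def IsPivot (r : I → V → ℕ) (m : I → V) (k : I) (x : V) : Prop :=
  (∀ i, i ≠ k → r i (m i) < r i x) ∧
    ∀ y, (∀ i, i ≠ k → r i (m i) < r i y) → r k y ≤ r k x

theorem IsPivot.unique {r : I → V → ℕ} (hr : ∀ i, Function.Injective (r i)) {m : I → V} {k : I}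
    {x y : V} (hx : IsPivot r m k x) (hy : IsPivot r m k y) : x = y :=
  hr k (le_antisymm (hy.2 x hx.1) (hx.2 y hy.1))

theorem IsPivot.exists [Finite V] {r : I → V → ℕ} {m : I → V} {k : I}
    {v : V} (hv : ∀ i, i ≠ k → r i (m i) < r i v) : ∃ x, IsPivot r m k x := by
  obtain ⟨x, hx, hmax⟩ := Set.exists_max_image
    {y | ∀ i, i ≠ k → r i (m i) < r i y} (r k) (Set.toFinite _) ⟨v, hv⟩
  exact ⟨x, hx, hmax⟩

variable [Fintype I] [DecidableEq I] [DecidableEq V]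

/-- The pivoting step: a dominant set `B` with `|I| - 1` elements has two distinguished indices
`a ≠ b`, those sharing their minimum over `B`, and the dominant sets with one more element are
obtained from the pivots at `a` and at `b`. -/
theorem Dominant.exists_pivots {r : I → V → ℕ} (hr : ∀ i, Function.Injective (r i))
    {B : Finset V} (hB : Dominant r B) (hne : B.Nonempty) (hcard : Fintype.card I = #B + 1) :
    ∃ m : I → V, (∀ i, m i ∈ B) ∧ (∀ i, ∀ x ∈ B, r i (m i) ≤ r i x) ∧
      ∃ a b, a ≠ b ∧ m a = m b ∧
        (∀ k, (univ.erase k).image m = B ↔ k = a ∨ k = b) ∧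
        (∀ x, (x ∉ B ∧ Dominant r (insert x B)) ↔ IsPivot r m a x ∨ IsPivot r m b x) := by
  choose m hmB hmin using fun i => exists_min_image B (r i) hne
  have hm_eq : ∀ i, ∀ z ∈ B, (∀ x ∈ B, r i z ≤ r i x) → m i = z := fun i z hz h =>
    hr i (le_antisymm (hmin i z hz) (h _ (hmB i)))
  have himg : univ.image m = B := by
    ext z
    constructor
    · intro h
      obtain ⟨i, -, rfl⟩ := mem_image.1 h
      exact hmB i
    · intro hz
      obtain ⟨i, hi⟩ := hB z
      exact mem_image.2 ⟨i, mem_univ _, hm_eq i z hz hi⟩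
  obtain ⟨a, -, b, -, hab, hmab, herase⟩ :=
    exists_pair_image_erase_eq himg (by rw [card_univ, hcard])
  refine ⟨m, hmB, hmin, a, b, hab, hmab, fun k => herase k (mem_univ k), fun x => ⟨?_, ?_⟩⟩
  · rintro ⟨hxB, hdom⟩
    obtain ⟨k, hk⟩ := hdom x
    -- each `z ∈ B` is the minimum of `insert x B` at some index, and there `x` is not minimal
    have hz : ∀ z ∈ B, ∃ i, m i = z ∧ ¬ r i x ≤ r i z := by
      intro z hz
      obtain ⟨i, hi⟩ := hdom z
      refine ⟨i, hm_eq i z hz fun w hw => hi w (mem_insert_of_mem hw), fun hle => hxB ?_⟩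
      rwa [hr i (le_antisymm hle (hi x (mem_insert_self _ _)))]
    have hkB : (univ.erase k).image m = B := by
      refine Subset.antisymm (himg ▸ image_subset_image (erase_subset _ _)) fun z hzB => ?_
      obtain ⟨i, hi, hlt⟩ := hz z hzB
      refine mem_image.2 ⟨i, mem_erase.2 ⟨?_, mem_univ _⟩, hi⟩
      rintro rfl
      exact hlt (hk z (mem_insert_of_mem hzB))
    have hpiv : IsPivot r m k x := by
      have hgt : ∀ i, i ≠ k → r i (m i) < r i x := by
        intro i hik
        by_contra! hle
        -- `x` would be minimal for two indices, leaving too few indices for the elements of `B`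
        have hsub : B ⊆ ((univ.erase k).erase i).image m := by
          intro z hzB
          obtain ⟨j, hj, hlt⟩ := hz z hzB
          refine mem_image.2 ⟨j, mem_erase.2 ⟨?_, mem_erase.2 ⟨?_, mem_univ _⟩⟩, hj⟩
          · rintro rfl
            exact hlt (hj ▸ hle)
          · rintro rfl
            exact hlt (hk z (mem_insert_of_mem hzB))
        have h1 := (card_le_card hsub).trans card_image_le
        rw [card_erase_of_mem (mem_erase.2 ⟨hik, mem_univ _⟩), card_erase_of_mem (mem_univ _),
          card_univ] at h1
        have := hne.card_pos
        omega
      refine ⟨hgt, fun y hy => ?_⟩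
      obtain ⟨i, hi⟩ := hdom y
      by_cases hik : i = k
      · subst hik
        exact hi x (mem_insert_self _ _)
      · exact absurd (hi _ (mem_insert_of_mem (hmB i))) (not_le.2 (hy i hik))
    rcases (herase k (mem_univ _)).1 hkB with rfl | rfl
    · exact Or.inl hpiv
    · exact Or.inr hpiv
  · have key : ∀ k, (k = a ∨ k = b) → IsPivot r m k x → x ∉ B ∧ Dominant r (insert x B) := by
      intro k hk hpiv
      constructor
      · intro hx
        rw [← (herase k (mem_univ _)).2 hk] at hx
        obtain ⟨i, hi, rfl⟩ := mem_image.1 hx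
        exact lt_irrefl _ (hpiv.1 i (mem_erase.1 hi).1)
      · have hxk : r k x ≤ r k (m k) := by
          obtain ⟨i, hi⟩ := hB x
          by_cases hik : i = k
          · subst hik
            exact hi _ (hmB _)
          · exact absurd (hi _ (hmB i)) (not_le.2 (hpiv.1 i hik))
        intro y
        by_cases hy : ∀ i, i ≠ k → r i (m i) < r i y
        · refine ⟨k, fun z hz => ?_⟩
          have hyx := hpiv.2 y hy
          rcases mem_insert.1 hz with rfl | hz
          · exact hyx
          · exact hyx.trans (hxk.trans (hmin k z hz))
        · push Not at hy
          obtain ⟨i, hik, hi⟩ := hy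
          refine ⟨i, fun z hz => ?_⟩
          rcases mem_insert.1 hz with rfl | hz
          · exact hi.trans (hpiv.1 i hik).le
          · exact hi.trans (hmin i z hz)
    rintro (h | h)
    · exact key a (Or.inl rfl) h
    · exact key b (Or.inr rfl) h

/-- Scarf's lemma. Besides ordinary elements, `V` contains a slack element `s j` for each index
`j`, which is lowest in the `j`-th order and above all ordinary elements in the other orders. Whatever
the colouring of the ordinary elements, if `s j` has colour `j` then some dominant set has all
colours. -/
theorem exists_dominant_image_eq_univ [Fintype V] [Nontrivial I] {r : I → V → ℕ}
    (hr : ∀ i, Function.Injective (r i)) {s : I → V} (hs_min : ∀ i v, r i (s i) ≤ r i v)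
    (hs_max : ∀ i j v, i ≠ j → v ∉ Set.range s → r i v < r i (s j))
    (hord : ∃ v, v ∉ Set.range s) {c : V → I} (hc : ∀ j, c (s j) = j) :
    ∃ R : Finset V, Dominant r R ∧ R.image c = univ := by
  classical
  by_contra! hno
  obtain ⟨v₀, hv₀⟩ := hord
  obtain ⟨i₀⟩ : Nonempty I := inferInstance
  have hsinj : Function.Injective s := fun i j h => by rw [← hc i, h, hc]
  -- "rooms" and "doors", incident when the door is contained in the room
  let rooms : Finset (Finset V) := univ.filter fun R =>
    Dominant r R ∧ #R = Fintype.card I ∧ R.image c = univ.erase i₀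
  let doors : Finset (Finset V) := univ.filter fun B =>
    Dominant r B ∧ #B + 1 = Fintype.card I ∧ B.image c = univ.erase i₀
  have hcount := sum_card_bipartiteAbove_eq_sum_card_bipartiteBelow
    (s := doors) (t := rooms) (fun B R => B ⊆ R)
  -- as no room carries all colours, each room has exactly two doors
  have heven : Even (∑ R ∈ rooms, #(bipartiteBelow (fun B R => B ⊆ R) doors R)) := by
    refine even_sum _ fun R hR => ?_
    obtain ⟨hdom, hcard, himg⟩ := (mem_filter.1 hR).2
    have hI : #(univ.erase i₀) + 1 = Fintype.card I := by
      rw [card_erase_of_mem (mem_univ _), card_univ]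
      have := Fintype.card_pos (α := I)
      omega
    obtain ⟨a, ha, b, hb, hab, -, herase⟩ :=
      exists_pair_image_erase_eq himg (by rw [hcard, hI])
    have : bipartiteBelow (fun B R => B ⊆ R) doors R = {R.erase a, R.erase b} := by
      ext B
      simp only [mem_bipartiteBelow, mem_insert, mem_singleton, doors, mem_filter, mem_univ,
        true_and]
      constructor
      · rintro ⟨⟨-, hBcard, hBimg⟩, hBR⟩
        obtain ⟨x, hx⟩ : ∃ x, R \ B = {x} := by
          rw [← card_eq_one, card_sdiff_of_subset hBR]
          omega
        have hxR : x ∈ R := (mem_sdiff.1 (hx ▸ mem_singleton_self x : x ∈ R \ B)).1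
        have hBx : B = R.erase x := by
          rw [erase_eq, ← hx, Finset.sdiff_sdiff_eq_self hBR]
        rcases (herase x hxR).1 (hBx ▸ hBimg) with rfl | rfl
        · exact Or.inl hBx
        · exact Or.inr hBx
      · have key : ∀ x ∈ R, (x = a ∨ x = b) → (Dominant r (R.erase x) ∧
            #(R.erase x) + 1 = Fintype.card I ∧ (R.erase x).image c = univ.erase i₀) ∧
            R.erase x ⊆ R := by
          intro x hx hxab
          refine ⟨⟨fun y => ?_, ?_, (herase x hx).2 hxab⟩, erase_subset _ _⟩
          · obtain ⟨i, hi⟩ := hdom y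
            exact ⟨i, fun z hz => hi z (mem_of_mem_erase hz)⟩
          · rw [card_erase_add_one hx, hcard]
        rintro (rfl | rfl)
        · exact key _ ha (Or.inl rfl)
        · exact key _ hb (Or.inr rfl)
    rw [this, card_pair]
    · exact even_two
    · intro h
      exact hab ((erase_inj R ha).1 h)
  -- the rooms above a door correspond to its pivots
  have habove : ∀ B ∈ doors, ∃ m : I → V, (∀ i, m i ∈ B) ∧ (∀ i, ∀ x ∈ B, r i (m i) ≤ r i x) ∧
      ∃ a b, a ≠ b ∧ m a = m b ∧ (∀ k, (univ.erase k).image m = B ↔ k = a ∨ k = b) ∧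
        (∀ x, ¬ (IsPivot r m a x ∧ IsPivot r m b x)) ∧
        #(bipartiteAbove (fun B R => B ⊆ R) rooms B) =
          #(univ.filter (IsPivot r m a)) + #(univ.filter (IsPivot r m b)) := by
    intro B hB
    obtain ⟨hdom, hcard, himg⟩ := (mem_filter.1 hB).2
    have hne : B.Nonempty := by
      rw [← card_pos]
      have := Fintype.one_lt_card (α := I)
      omega
    obtain ⟨m, hmB, hmin, a, b, hab, hmab, herase, hpiv⟩ :=
      hdom.exists_pivots hr hne hcard.symm
    have hdisj : ∀ x, ¬ (IsPivot r m a x ∧ IsPivot r m b x) := by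
      rintro x ⟨ha, hb⟩
      obtain ⟨i, hi⟩ := hdom x
      by_cases hia : i = a
      · subst hia
        exact absurd (hi _ (hmB i)) (not_le.2 (hb.1 i hab))
      · exact absurd (hi _ (hmB i)) (not_le.2 (ha.1 i hia))
    refine ⟨m, hmB, hmin, a, b, hab, hmab, herase, hdisj, ?_⟩
    rw [← card_union_of_disjoint
      (disjoint_filter.2 fun x _ h1 h2 => hdisj x ⟨h1, h2⟩), ← filter_or]
    symm
    refine card_bij (fun x _ => insert x B) ?_ ?_ ?_
    · intro x hx
      obtain ⟨hxB, hxd⟩ := (hpiv x).2 (mem_filter.1 hx).2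
      have hsub : univ.erase i₀ ⊆ (insert x B).image c :=
        himg ▸ image_subset_image (subset_insert _ _)
      simp only [mem_bipartiteAbove, rooms, mem_filter, mem_univ, true_and]
      refine ⟨⟨hxd, by rw [card_insert_of_notMem hxB, hcard], ?_⟩, subset_insert _ _⟩
      refine Subset.antisymm (fun j hj => mem_erase.2 ⟨?_, mem_univ _⟩) hsub
      rintro rfl
      refine hno _ hxd (eq_univ_iff_forall.2 fun k => ?_)
      by_cases hk : k = j
      · exact hk ▸ hj
      · exact hsub (mem_erase.2 ⟨hk, mem_univ _⟩)
    · intro x hx y hy hxy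
      have hxB := ((hpiv x).2 (mem_filter.1 hx).2).1
      have hmem : x ∈ insert y B := hxy ▸ mem_insert_self x B
      exact (mem_insert.1 hmem).resolve_right hxB
    · intro R hR
      simp only [mem_bipartiteAbove, rooms, mem_filter, mem_univ, true_and] at hR
      obtain ⟨⟨hRd, hRcard, -⟩, hBR⟩ := hR
      obtain ⟨x, hx⟩ : ∃ x, R \ B = {x} := by
        rw [← card_eq_one, card_sdiff_of_subset hBR]
        omega
      have hxB : x ∉ B := (mem_sdiff.1 (hx ▸ mem_singleton_self x : x ∈ R \ B)).2
      have hRx : insert x B = R := by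
        rw [insert_eq, ← hx, sdiff_union_of_subset hBR]
      exact ⟨x, mem_filter.2 ⟨mem_univ _, (hpiv x).1 ⟨hxB, hRx ▸ hRd⟩⟩, hRx⟩
  have hone : ∀ (m : I → V) k, (∃ x, IsPivot r m k x) → #(univ.filter (IsPivot r m k)) = 1 := by
    rintro m k ⟨x, hx⟩
    refine card_eq_one.2 ⟨x, ?_⟩
    ext y
    simp only [mem_filter, mem_univ, true_and, mem_singleton]
    exact ⟨fun hy => hy.unique hr hx, fun h => h ▸ hx⟩
  -- the only door leading outside consists of the slack elements `s j`, `j ≠ i₀`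
  have hodd : Odd (∑ B ∈ doors, #(bipartiteAbove (fun B R => B ⊆ R) rooms B)) := by
    rw [odd_sum_iff_odd_card_odd]
    suffices h : doors.filter (fun B => Odd #(bipartiteAbove (fun B R => B ⊆ R) rooms B)) =
        {(univ.erase i₀).image s} by
      rw [h, card_singleton]
      exact odd_one
    ext B
    rw [mem_filter, mem_singleton]
    constructor
    · rintro ⟨hB, hBodd⟩
      obtain ⟨m, hmB, hmin, a, b, hab, hmab, herase, -, hcard⟩ := habove B hB
      by_cases hBs : ∃ v ∈ B, v ∉ Set.range s
      · exfalso
        obtain ⟨v, hvB, hvs⟩ := hBs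
        have hex : ∀ k, ∃ x, IsPivot r m k x := fun k =>
          IsPivot.exists (v := s k) fun i hik =>
            (hmin i v hvB).trans_lt (hs_max i k v hik hvs)
        rw [hcard, hone m a (hex a), hone m b (hex b)] at hBodd
        exact absurd hBodd (by decide)
      · push Not at hBs
        obtain ⟨-, -, himg⟩ := (mem_filter.1 hB).2
        rw [← himg, image_image]
        ext v
        constructor
        · intro hv
          obtain ⟨j, rfl⟩ := hBs v hv
          exact mem_image.2 ⟨s j, hv, by simp [hc]⟩
        · intro hv
          obtain ⟨w, hw, rfl⟩ := mem_image.1 hv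
          obtain ⟨j, rfl⟩ := hBs w hw
          simpa [hc] using hw
    · intro hBeq
      have hB : B ∈ doors := by
        refine mem_filter.2 ⟨mem_univ _, fun y => ?_, ?_, ?_⟩
        · by_cases hy : y ∈ Set.range s
          · obtain ⟨j, rfl⟩ := hy
            exact ⟨j, fun x _ => hs_min j x⟩
          · refine ⟨i₀, fun x hx => ?_⟩
            rw [hBeq] at hx
            obtain ⟨j, hj, rfl⟩ := mem_image.1 hx
            exact (hs_max i₀ j y (mem_erase.1 hj).1.symm hy).le
        · rw [hBeq, card_image_of_injective _ hsinj, card_erase_add_one (mem_univ _), card_univ]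
        · rw [hBeq, image_image]
          have : c ∘ s = id := funext hc
          rw [this, image_id]
      refine ⟨hB, ?_⟩
      obtain ⟨m, hmB, hmin, a, b, hab, hmab, herase, -, hcard⟩ := habove B hB
      have hms : ∀ i, i ≠ i₀ → m i = s i := by
        intro i hi
        have : s i ∈ B := hBeq ▸ mem_image_of_mem s (mem_erase.2 ⟨hi, mem_univ _⟩)
        exact hr i (le_antisymm (hmin i _ this) (hs_min i _))
      -- the pivot at `i₀` exists, the one at the other index `k` does not
      have h1 : #(univ.filter (IsPivot r m i₀)) = 1 := by
        refine hone m i₀ (IsPivot.exists (v := v₀) fun i hi => ?_)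
        rw [hms i hi]
        refine lt_of_le_of_ne (hs_min i v₀) fun h => hv₀ ⟨i, hr i h⟩
      have h0 : ∀ k, k ≠ i₀ → m k = m i₀ → #(univ.filter (IsPivot r m k)) = 0 := by
        intro k hk hmk
        rw [card_eq_zero, filter_eq_empty_iff]
        rintro y - ⟨hy, -⟩
        have hyk := hy i₀ hk.symm
        rw [← hmk, hms k hk] at hyk
        by_cases hys : y ∈ Set.range s
        · obtain ⟨j, rfl⟩ := hys
          by_cases hjk : j = k
          · subst hjk
            exact lt_irrefl _ hyk
          · exact absurd (hy j hjk) (not_lt.2 (hs_min j _))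
        · exact absurd hyk (not_lt.2 (hs_max i₀ k y hk.symm hys).le)
      have hi₀ : i₀ = a ∨ i₀ = b := by
        rw [← herase, hBeq]
        exact image_congr fun i hi => hms i (by simpa using hi)
      rcases hi₀ with rfl | rfl
      · rw [hcard, h1, h0 b hab.symm hmab.symm]
        decide
      · rw [hcard, h1, h0 a hab hmab]
        decide
  rw [hcount] at hodd
  exact (Nat.not_odd_iff_even.2 heven) hodd

end Scarf

/-! ### Variational inequalities on the standard simplex -/

namespace Scarf

open Finset

/-- The points of the standard simplex with coordinates in `ℕ / l`, scaled by `l`. -/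
abbrev Grid (I : Type*) [Fintype I] (l : ℕ) : Type _ :=
  {x : I → Fin (l + 1) // ∑ i, (x i : ℕ) = l}

variable {I : Type*} [Fintype I] [DecidableEq I]

/-- The `i`-th coordinate, shifted by one, of a grid point or of a slack element; the slack
element of index `j` gets the lowest value at `j` and the highest value elsewhere. -/
def level {l : ℕ} (i : I) : Grid I l ⊕ I → ℕ
  | Sum.inl x => (x.1 i : ℕ) + 1
  | Sum.inr j => if i = j then 0 else l + 2

/-- Scarf's lemma on a grid of mesh `1 / l`: whatever the colouring, there are points of all
colours close together, except that a colour `i` may be missing if the `i`-th coordinate is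
small. -/
theorem exists_grid_cluster [Nontrivial I] {l : ℕ} (c : Grid I l → I) :
    ∃ x : Grid I l, ∀ i, (x.1 i : ℕ) < Fintype.card I ∨
      ∃ y : Grid I l, c y = i ∧ ∀ j, (x.1 j : ℕ) < y.1 j + Fintype.card I ∧
        (y.1 j : ℕ) < x.1 j + Fintype.card I := by
  classical
  let V := Grid I l ⊕ I
  -- rank lexicographically, by level and then by an arbitrary enumeration to break ties
  let N := Fintype.card V
  let e : V ≃ Fin N := Fintype.equivFin V
  let r : I → V → ℕ := fun i v => level i v * N + e v
  have hlt : ∀ i u v, level i u < level i v → r i u < r i v := by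
    intro i u v h
    have h1 := (e u).isLt
    have h2 : (level i u + 1) * N ≤ level i v * N := Nat.mul_le_mul_right N h
    simp only [r]
    linarith
  have hle : ∀ i u v, r i u ≤ r i v → level i u ≤ level i v := fun i u v h =>
    not_lt.1 fun h' => absurd (hlt i v u h') (not_lt.2 h)
  have hr : ∀ i, Function.Injective (r i) := by
    intro i u v h
    have hl := le_antisymm (hle i u v h.le) (hle i v u h.ge)
    simp only [r, hl] at h
    exact e.injective (Fin.ext (Nat.add_left_cancel h))
  have hslack : ∀ i (v : V), v ≠ Sum.inr i → level i (Sum.inr i : V) < level i v := by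
    rintro i (x | j) h
    · simp [level]
    · have : i ≠ j := fun hij => h (by rw [hij])
      simp [level, this]
  have hgrid : ∀ i (x : Grid I l), level i (Sum.inl x : V) < l + 2 := fun i x => by
    have := (x.1 i).isLt
    simp only [level]
    omega
  obtain ⟨i₁⟩ : Nonempty I := inferInstance
  have hne : ∃ v : V, v ∉ Set.range Sum.inr := by
    refine ⟨Sum.inl ⟨Pi.single i₁ (Fin.last l), ?_⟩, by simp⟩
    rw [sum_eq_single i₁ (fun j _ hj => by simp [Pi.single_eq_of_ne hj]) (by simp)]
    simp
  obtain ⟨R, hdom, himg⟩ := exists_dominant_image_eq_univ (r := r) hr (s := Sum.inr)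
    (fun i v => by
      by_cases h : v = Sum.inr i
      · rw [h]
      · exact (hlt _ _ _ (hslack i v h)).le)
    (by
      rintro i j (x | k) hij hv
      · apply hlt
        have h1 := hgrid i x
        have h2 : level i (Sum.inr j : V) = l + 2 := by simp [level, hij]
        exact h2 ▸ h1
      · exact absurd ⟨k, rfl⟩ hv)
    hne (c := Sum.elim c id) (fun j => rfl)
  -- the indices whose slack element is absent from `R`, and the smallest coordinates over `R`
  let C := univ.filter fun i => (Sum.inr i : V) ∉ R
  let S := univ.filter fun x : Grid I l => (Sum.inl x : V) ∈ R
  have hdomC : ∀ y : Grid I l, ∃ i ∈ C, ∀ x ∈ S, (y.1 i : ℕ) ≤ x.1 i := by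
    intro y
    obtain ⟨i, hi⟩ := hdom (Sum.inl y)
    refine ⟨i, mem_filter.2 ⟨mem_univ _, fun hR => ?_⟩, fun x hx => ?_⟩
    · exact absurd (hle _ _ _ (hi _ hR)) (not_le.2 (hslack i _ (by simp)))
    · have := hle _ _ _ (hi _ (mem_filter.1 hx).2)
      simpa [level] using this
  have hS : S.Nonempty := by
    by_contra hS
    obtain ⟨v, hv⟩ := hne
    obtain ⟨i, hi⟩ := hdom v
    obtain ⟨w, hw, hwi⟩ := mem_image.1 (himg ▸ mem_univ i)
    rcases w with x | j
    · exact hS ⟨x, mem_filter.2 ⟨mem_univ _, hw⟩⟩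
    · obtain rfl : j = i := hwi
      exact absurd (hle _ _ _ (hi _ hw)) (not_le.2 (hslack j v fun h => hv ⟨j, h.symm⟩))
  choose p hpS hpmin using fun i => exists_min_image S (fun x : Grid I l => (x.1 i : ℕ)) hS
  have hsum : l < ∑ i ∈ C, ((p i).1 i + 1 : ℕ) := by
    by_contra! hcon
    set T := ∑ i ∈ C, ((p i).1 i + 1 : ℕ) with hT
    -- otherwise some grid point exceeds all the minima
    let y : I → ℕ := fun i => (if i ∈ C then ((p i).1 i + 1 : ℕ) else 0) +
      (if i = i₁ then l - T else 0)
    have hy : ∑ i, y i = l := by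
      simp only [y]
      rw [sum_add_distrib, sum_ite_mem, univ_inter, sum_ite_eq', if_pos (mem_univ _), ← hT]
      omega
    have hyl : ∀ i, y i < l + 1 := fun i =>
      Nat.lt_succ_of_le (hy ▸ single_le_sum (f := y) (fun _ _ => Nat.zero_le _) (mem_univ i))
    obtain ⟨i, hiC, hi⟩ := hdomC ⟨fun i => ⟨y i, hyl i⟩, hy⟩
    have := hi _ (hpS i)
    simp only [y, if_pos hiC] at this
    omega
  have hCI : #C ≤ Fintype.card I := card_le_univ C
  have hC : ∀ x ∈ S, ∀ i ∈ C, (x.1 i : ℕ) < (p i).1 i + Fintype.card I := by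
    intro x hx i hi
    have h1 : ∑ j ∈ C, (x.1 j : ℕ) ≤ l :=
      (sum_le_sum_of_subset (f := fun j => (x.1 j : ℕ)) (subset_univ C)).trans_eq x.2
    have h2 : ∑ j ∈ C.erase i, ((p j).1 j : ℕ) ≤ ∑ j ∈ C.erase i, (x.1 j : ℕ) :=
      sum_le_sum fun j _ => hpmin j x hx
    rw [sum_add_distrib, sum_const, smul_eq_mul, mul_one] at hsum
    rw [← add_sum_erase _ _ hi] at h1 hsum
    omega
  have hnC : ∀ x ∈ S, ∀ i, i ∉ C → (x.1 i : ℕ) < Fintype.card I := by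
    intro x hx i hi
    have h1 : ∑ j ∈ insert i C, (x.1 j : ℕ) ≤ l :=
      (sum_le_sum_of_subset (f := fun j => (x.1 j : ℕ)) (subset_univ _)).trans_eq x.2
    have h2 : ∑ j ∈ C, ((p j).1 j : ℕ) ≤ ∑ j ∈ C, (x.1 j : ℕ) :=
      sum_le_sum fun j _ => hpmin j x hx
    rw [sum_add_distrib, sum_const, smul_eq_mul, mul_one] at hsum
    rw [sum_insert hi] at h1
    omega
  have hclose : ∀ x ∈ S, ∀ y ∈ S, ∀ j, (x.1 j : ℕ) < y.1 j + Fintype.card I := by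
    intro x hx y hy j
    by_cases hj : j ∈ C
    · have h1 := hC x hx j hj
      have h2 := hpmin j y hy
      omega
    · have := hnC x hx j hj
      omega
  obtain ⟨x, hx⟩ := hS
  refine ⟨x, fun i => ?_⟩
  by_cases hi : i ∈ C
  · obtain ⟨w, hw, hwi⟩ := mem_image.1 (himg ▸ mem_univ i)
    rcases w with y | j
    · have hy : y ∈ S := mem_filter.2 ⟨mem_univ _, hw⟩
      exact Or.inr ⟨y, hwi, fun j => ⟨hclose x hx y hy j, hclose y hy x hx j⟩⟩
    · obtain rfl : j = i := hwi
      exact absurd hw (mem_filter.1 hi).2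
  · exact Or.inl (hnC x hx i hi)

end Scarf

section

open Finset Filter Topology

/-- The variational inequality on the standard simplex for a continuous map `G` is solvable, in
its complementarity form: there is a point `u` at which every coordinate `i` with `u i > 0`
minimises `G u`. -/
theorem exists_mem_stdSimplex_complementarity {I : Type*} [Fintype I] [Nontrivial I]
    {G : (I → ℝ) → I → ℝ} (hG : Continuous G) :
    ∃ u ∈ stdSimplex ℝ I, ∀ i, 0 < u i → ∀ k, G u i ≤ G u k := by
  classical
  have hmin : ∀ v : I → ℝ, ∃ i, ∀ k, G v i ≤ G v k := fun v => Finite.exists_min (G v)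
  choose c hc using hmin
  let pt : ∀ l : ℕ, Scarf.Grid I (l + 1) → I → ℝ := fun l x i => (x.1 i : ℝ) / (l + 1 : ℕ)
  have hpt : ∀ l x, pt l x ∈ stdSimplex ℝ I := by
    refine fun l x => ⟨fun i => by positivity, ?_⟩
    simp only [pt]
    rw [← sum_div, ← Nat.cast_sum, x.2]
    exact div_self (by positivity)
  -- near-solutions at mesh `1 / (l + 1)`
  choose x hx using fun l : ℕ => Scarf.exists_grid_cluster fun x : Scarf.Grid I (l + 1) =>
    c (pt l x)
  obtain ⟨u, hu, φ, hφ, hlim⟩ :=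
    (isCompact_stdSimplex ℝ I).tendsto_subseq (fun l => hpt l (x l))
  refine ⟨u, hu, fun i hi k => ?_⟩
  by_contra! hlt
  have hopen : ∀ᶠ v in 𝓝 u, G v k < G v i :=
    ((continuous_apply k).comp hG).continuousAt.eventually_lt
      ((continuous_apply i).comp hG).continuousAt hlt
  obtain ⟨δ, hδ, hball⟩ := Metric.eventually_nhds_iff.1 hopen
  have hmesh : Tendsto (fun l : ℕ => (Fintype.card I : ℝ) / ((φ l + 1 : ℕ) : ℝ)) atTop (𝓝 0) :=
    (tendsto_const_div_atTop_nhds_zero_nat _).comp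
      ((tendsto_add_atTop_nat 1).comp hφ.tendsto_atTop)
  have hev1 := (tendsto_order.1 hmesh).2 (δ / 2) (by positivity)
  have hev2 := (tendsto_order.1 hmesh).2 (u i / 2) (by positivity)
  have hev3 := (Metric.tendsto_nhds.1 hlim) (δ / 2) (by positivity)
  have hev4 := (tendsto_order.1 ((tendsto_pi_nhds.1 hlim) i)).1 (u i / 2) (by linarith)
  obtain ⟨l, h1, h2, h3, h4⟩ := (hev1.and (hev2.and (hev3.and hev4))).exists
  have hpos : (0 : ℝ) < ((φ l + 1 : ℕ) : ℝ) := by positivity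
  rcases hx (φ l) i with hsmall | ⟨y, hyc, hyx⟩
  · have : pt (φ l) (x (φ l)) i ≤ (Fintype.card I : ℝ) / ((φ l + 1 : ℕ) : ℝ) := by
      simp only [pt]
      gcongr
    exact absurd h4 (not_lt.2 (this.trans h2.le))
  · have hdist : dist (pt (φ l) y) (pt (φ l) (x (φ l))) ≤
        (Fintype.card I : ℝ) / ((φ l + 1 : ℕ) : ℝ) := by
      rw [dist_pi_le_iff (by positivity)]
      intro j
      obtain ⟨ha, hb⟩ := hyx j
      rw [Real.dist_eq]
      simp only [pt]
      rw [← sub_div, abs_div, abs_of_pos hpos]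
      gcongr
      have ha' : (((x (φ l)).1 j : ℕ) : ℝ) ≤ (y.1 j : ℕ) + Fintype.card I := by
        exact_mod_cast ha.le
      have hb' : ((y.1 j : ℕ) : ℝ) ≤ ((x (φ l)).1 j : ℕ) + Fintype.card I := by
        exact_mod_cast hb.le
      rw [abs_le]
      constructor <;> linarith
    have hclose : dist (pt (φ l) y) u < δ := by
      have := dist_triangle (pt (φ l) y) (pt (φ l) (x (φ l))) u
      have h3' : dist (pt (φ l) (x (φ l))) u < δ / 2 := h3
      linarith
    have := hball hclose
    exact absurd (hyc ▸ hc (pt (φ l) y) k) (not_le.2 this)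

end

/-! ### Semi-positive tensors -/

namespace RealTensor

open Finset Filter Topology

variable {m n : ℕ}

theorem continuous_applyVec (A : RealTensor m n) : Continuous A.applyVec := by
  unfold applyVec
  fun_prop

theorem applyVec_smul (A : RealTensor m n) (s : ℝ) (x : Fin n → ℝ) :
    A.applyVec (s • x) = s ^ (m - 1) • A.applyVec x := by
  ext i
  simp only [applyVec, Pi.smul_apply, smul_eq_mul, prod_mul_distrib, prod_const, card_univ,
    Fintype.card_fin, mul_sum]
  exact sum_congr rfl fun j _ => by ring

theorem IsSemiPositive.isR {A : RealTensor m n} (hA : A.IsSemiPositive) (hR₀ : A.IsR₀) :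
    A.IsR := by
  rintro ⟨x, t, hx0, hx, ht, hpos, hzero⟩
  obtain ⟨k, hk, hAk⟩ := hA x hx hx0
  have := hpos k hk
  obtain rfl : t = 0 := by linarith
  exact hR₀ ⟨x, hx0, hx, ht, hpos, hzero⟩

/-- The complementarity problem on the truncated orthant `{x ≥ 0, ∑ x ≤ s}` is solvable. If the
constraint `∑ x ≤ s` is not active then `x` solves the full problem; otherwise the scaled point
`y = x / s` of the simplex solves a perturbation of `RSystem`. -/
theorem exists_solvesTCP_or_truncated (A : RealTensor m n) (hn : 0 < n) (q : Fin n → ℝ) {s : ℝ}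
    (hs : 0 < s) : (∃ x, SolvesTCP q A x) ∨
      ∃ y ∈ stdSimplex ℝ (Fin n), ∃ t : ℝ, 0 ≤ t ∧
        (∀ i, 0 ≤ (s ^ (m - 1))⁻¹ * q i + A.applyVec y i + t) ∧
        ∀ i, 0 < y i → (s ^ (m - 1))⁻¹ * q i + A.applyVec y i + t = 0 := by
  have : Nonempty (Fin n) := ⟨⟨0, hn⟩⟩
  let G : (Option (Fin n) → ℝ) → Option (Fin n) → ℝ := fun u k =>
    k.elim 0 fun i => q i + A.applyVec (s • fun j => u (some j)) i
  have hG : Continuous G := by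
    refine continuous_pi fun k => ?_
    rcases k with _ | i
    · exact continuous_const
    · exact continuous_const.add ((continuous_apply i).comp (A.continuous_applyVec.comp
        (by fun_prop)))
  obtain ⟨u, ⟨hu0, hu1⟩, hu⟩ := exists_mem_stdSimplex_complementarity hG
  have hGsome : ∀ i, G u (some i) = q i + A.applyVec (s • fun j => u (some j)) i := fun i => rfl
  have hGnone : G u none = 0 := rfl
  obtain ⟨k, hk⟩ := Finite.exists_min (G u)
  have hkpos : ∀ i, 0 < u i → G u i = G u k := fun i hi => le_antisymm (hu i hi k) (hk i)
  rcases (hGnone ▸ hk none : G u k ≤ 0).eq_or_lt with h0 | hneg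
  · refine Or.inl ⟨s • fun j => u (some j), fun i => mul_nonneg hs.le (hu0 _), fun i => ?_, ?_⟩
    · have := hk (some i)
      rwa [h0] at this
    · refine sum_eq_zero fun i _ => ?_
      rcases (hu0 (some i)).eq_or_lt with h | h
      · simp [← h]
      · have := hkpos _ h
        rw [h0, hGsome] at this
        rw [Pi.add_apply, this, mul_zero]
  · right
    have hnone : u none = 0 := by
      by_contra h
      have := hkpos none (lt_of_le_of_ne (hu0 none) (Ne.symm h))
      rw [hGnone] at this
      linarith
    have hp : 0 < s ^ (m - 1) := by positivity
    have hscale : ∀ i, (s ^ (m - 1))⁻¹ * q i + A.applyVec (fun j => u (some j)) i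
        + (s ^ (m - 1))⁻¹ * (-G u k) = (s ^ (m - 1))⁻¹ * (G u (some i) - G u k) := by
      intro i
      rw [hGsome, applyVec_smul, Pi.smul_apply, smul_eq_mul]
      field_simp
      ring
    refine ⟨fun j => u (some j), ⟨fun j => hu0 _, ?_⟩, (s ^ (m - 1))⁻¹ * (-G u k), ?_, ?_, ?_⟩
    · rwa [Fintype.sum_option, hnone, zero_add] at hu1
    · exact mul_nonneg (by positivity) (by linarith)
    · intro i
      rw [hscale]
      exact mul_nonneg (by positivity) (sub_nonneg.2 (hk _))
    · intro i hi
      rw [hscale, hkpos _ hi, sub_self, mul_zero]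

/-- If the complementarity problem has no solution, then the truncated problems have rescaled
solutions on the simplex that accumulate at a solution of `RSystem`. -/
theorem IsR.isQ {A : RealTensor m n} (hm : 2 ≤ m) (hR : A.IsR) : A.IsQ := by
  intro q
  rcases Nat.eq_zero_or_pos n with rfl | hn
  · exact ⟨0, le_rfl, fun i => i.elim0, by simp⟩
  by_contra hno
  have hseq := fun k : ℕ => (A.exists_solvesTCP_or_truncated hn q
    (Nat.cast_add_one_pos (α := ℝ) k)).resolve_left hno
  choose y hy t ht hnonneg hcompl using hseq
  set ε : ℕ → ℝ := fun k => (((k : ℝ) + 1) ^ (m - 1))⁻¹ with hε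
  have hεlim : Tendsto ε atTop (𝓝 0) :=
    tendsto_inv_atTop_zero.comp ((tendsto_pow_atTop (by omega)).comp
      (tendsto_atTop_add_const_right _ _ tendsto_natCast_atTop_atTop))
  -- complementarity and `∑ y = 1` determine the multiplier, so it converges along with `y`
  have hteq : ∀ k, t k = -∑ i, y k i * (ε k * q i + A.applyVec (y k) i) := by
    intro k
    have h : ∑ i, y k i * (ε k * q i + A.applyVec (y k) i + t k) = 0 := by
      refine sum_eq_zero fun i _ => ?_
      rcases ((hy k).1 i).eq_or_lt with h | h
      · rw [← h, zero_mul]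
      · rw [hcompl k i h, mul_zero]
    simp only [mul_add _ _ (t k), sum_add_distrib, ← sum_mul, (hy k).2] at h
    linarith
  obtain ⟨x, hx, φ, hφ, hlim⟩ := (isCompact_stdSimplex ℝ (Fin n)).tendsto_subseq hy
  have hxi : ∀ i, Tendsto (fun k => y (φ k) i) atTop (𝓝 (x i)) := tendsto_pi_nhds.1 hlim
  have hF : ∀ i, Tendsto (fun k => ε (φ k) * q i + A.applyVec (y (φ k)) i) atTop
      (𝓝 (A.applyVec x i)) := by
    intro i
    have h1 := (hεlim.comp hφ.tendsto_atTop).mul_const (q i)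
    have h2 := tendsto_pi_nhds.1 ((A.continuous_applyVec.tendsto x).comp hlim) i
    simpa using h1.add h2
  have htlim : Tendsto (fun k => t (φ k)) atTop (𝓝 (-∑ i, x i * A.applyVec x i)) := by
    simp only [hteq]
    exact (tendsto_finsetSum _ fun i _ => (hxi i).mul (hF i)).neg
  refine hR ⟨x, -∑ i, x i * A.applyVec x i, ?_, hx.1, ?_, ?_, ?_⟩
  · rintro rfl
    simpa using hx.2
  · exact ge_of_tendsto' htlim fun k => ht _
  · intro i hi
    refine tendsto_nhds_unique ((hF i).add htlim) (tendsto_const_nhds.congr' ?_)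
    filter_upwards [(tendsto_order.1 (hxi i)).1 0 hi] with k hk
    exact (hcompl _ i hk).symm
  · intro j _
    exact ge_of_tendsto' ((hF j).add htlim) fun k => hnonneg _ j

end RealTensor

theorem mainTheorem4 {m n : ℕ} (hm : 2 ≤ m) (A : RealTensor m n)
    (hR₀ : A.IsR₀) (hA : A.IsSemiPositive) : A.IsR ∧ A.IsQ :=
  ⟨hA.isR hR₀, (hA.isR hR₀).isQ hm⟩
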